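/- Let $G$ be a group. Write $\mathrm{cd}_{\mathbb{Q}} G$ for the projective dimension of the trivial module $\mathbb{Q}$ over the group ring $\mathbb{Q}G$. A $\mathbb{Z}G$-module is called Gorenstein projective if it is isomorphic to the cokernel of a differential $T_{k+1}\to T_k$ of an acyclic complex $T_*=(\cdots\to T_1\to T_0\to T_{-1}\to\cdots)$ of projective $\mathbb{Z}G$-modules such that $\mathrm{Hom}_{\mathbb{Z}G}(T_*,Q)$ is acyclic for every projective $\mathbb{Z}G$-module $Q$. Write $\mathrm{Gcd}\,G\in\{0,1,2,\dots\}\cup\{\infty\}$ for the Gorenstein projective dimension of the trivial $\mathbb{Z}G$-module $\mathbb{Z}$, that is, the least $n$ for which there is an exact sequence $0\to A_n\to\cdots\to A_0\to\mathbb{Z}\to 0$ of $\mathbb{Z}G$-modules with every $A_i$ Gorenstein projective, and $\infty$ if there is no such $n$. If $\mathrm{cd}_{\mathbb{Q}} G<\infty$, then $\mathrm{cd}_{\mathbb{Q}} G\le \mathrm{Gcd}\,G$. -/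

import Mathlib

open CategoryTheory CategoryTheory.Limits

universe u

/-- A complex of projective modules indexed by `ℤ` which is exact and stays exact under
`Hom(-, Q)` for every projective module `Q`: every map `f : Tᵢ ⟶ Q` that vanishes on the
image of `Tᵢ₊₁` factors through `Tᵢ ⟶ Tᵢ₋₁`. (Such a `T` is a strong complete resolution of
each of its cokernels, since its truncations are projective resolutions of them.) -/
structure IsStrongCompleteResolution {A : Type u} [Ring A]
    (T : ChainComplex (ModuleCat.{u} A) ℤ) : Prop where
  projective (i : ℤ) : Projective (T.X i)
  acyclic : T.Acyclic
  hom_acyclic (Q : ModuleCat.{u} A) (_ : Projective Q) (i : ℤ) (f : T.X i ⟶ Q)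
    (_ : T.d (i + 1) i ≫ f = 0) : ∃ g : T.X (i - 1) ⟶ Q, T.d i (i - 1) ≫ g = f

/-- A module is Gorenstein projective if it is a cokernel in a strong complete resolution. -/
def IsGorensteinProjective {A : Type u} [Ring A] (M : ModuleCat.{u} A) : Prop :=
  ∃ T : ChainComplex (ModuleCat.{u} A) ℤ, IsStrongCompleteResolution T ∧
    ∃ k : ℤ, Nonempty (M ≅ cokernel (T.d (k + 1) k))

/-- `M` has a resolution `0 ⟶ Cₙ ⟶ ⋯ ⟶ C₀ ⟶ M ⟶ 0` by Gorenstein projective modules. -/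
def HasGorensteinProjectiveResolution {A : Type u} [Ring A] (M : ModuleCat.{u} A)
    (n : ℕ) : Prop :=
  ∃ (C : ChainComplex (ModuleCat.{u} A) ℕ) (ε : C.X 0 ⟶ M) (w : C.d 1 0 ≫ ε = 0),
    (∀ i, IsGorensteinProjective (C.X i)) ∧ (∀ i, n < i → IsZero (C.X i)) ∧
    (∀ i, C.ExactAt (i + 1)) ∧ (ShortComplex.mk (C.d 1 0) ε w).Exact ∧ Epi ε

/-- The Gorenstein projective dimension: the minimal length of a resolution by Gorenstein
projective modules, and `⊤` if there is none of finite length. -/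
noncomputable def gorensteinProjectiveDimension {A : Type u} [Ring A]
    (M : ModuleCat.{u} A) : ℕ∞ :=
  sInf {d : ℕ∞ | ∃ n : ℕ, d = n ∧ HasGorensteinProjectiveResolution M n}

/-- The ring `R` as a module over the group ring `R[G]`, with trivial action of `G`. -/
noncomputable def trivialModule (R : Type) [CommRing R] (G : Type u) [Group G] :
    ModuleCat.{u} (MonoidAlgebra R G) :=
  ModuleCat.of (MonoidAlgebra R G) (Representation.trivial R G (ULift.{u} R)).asModule

/-- The cohomological dimension `cd_R G`, the projective dimension of `R` over `R[G]`. -/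
noncomputable def cohomologicalDimension (R : Type) [CommRing R] (G : Type u) [Group G] :
    WithBot ℕ∞ :=
  projectiveDimension (trivialModule R G)

/-- The Gorenstein cohomological dimension of `G` over `R`, the Gorenstein projective
dimension of `R` over `R[G]`. -/
noncomputable def gorensteinCohomologicalDimension (R : Type) [CommRing R] (G : Type u)
    [Group G] : ℕ∞ :=
  gorensteinProjectiveDimension (trivialModule R G)

/-! Rationalization ℚ ⊗ - is exact and left adjoint to restriction along ℤG → ℚG, so a Gorenstein
projective resolution of ℤ of length n becomes a resolution of ℚ by modules ℚ ⊗ N. If Ext(ℚ ⊗ N, F)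
vanishes in positive degrees for every projective ℚG-module F, dimension shifting kills Ext(ℚ, F)
above degree n. As cd_ℚ G is finite, projective coefficients detect it
(`hasProjectiveDimensionLT_of_ext_projective`), so it is at most n.

By adjunction the vanishing amounts to exactness of Hom(T, F) over ℤG for a strong complete
resolution T. The restriction of F need not be projective, but it is a summand of a free ℚG-module,
which is the telescope of multiplications by 1, 2, 3, … on a free ℤG-module and so has projective
dimension at most one over ℤG. That is enough (`IsStrongCompleteResolution.isHomAcyclic`). -/

/-- A differential `X₁ ⟶ X₀` of a complex exact at `X₁` yields a short exact sequence of
cokernels `0 ⟶ coker (X₂ ⟶ X₁) ⟶ X₀ ⟶ coker (X₁ ⟶ X₀) ⟶ 0`. -/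
lemma shortExact_cokernel_desc {C : Type*} [Category* C] [Abelian C] {X₂ X₁ X₀ : C}
    {a : X₂ ⟶ X₁} {b : X₁ ⟶ X₀} (w : a ≫ b = 0) (h : (ShortComplex.mk a b w).Exact) :
    (ShortComplex.mk (cokernel.desc a b w) (cokernel.π b)
      (by rw [← cancel_epi (cokernel.π a)]; simp)).ShortExact where
  exact := by
    refine ShortComplex.exact_of_g_is_cokernel _
      (CokernelCofork.IsColimit.ofπ' _ _ fun k hk ↦ ⟨cokernel.desc b k ?_, ?_⟩)
    · rw [← cokernel.π_desc a b w, Category.assoc, hk, comp_zero]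
    · simp
  mono_f := h.mono_cokernelDesc
  epi_g := inferInstance

/-! ### Vanishing of Ext and dimension shifting -/

section Ext

variable {C : Type*} [Category* C] [Abelian C] [HasExt.{u} C]

open Abelian

lemma ext_eq_zero_of_iso {X X' Y : C} (i : X ≅ X') {j : ℕ} (h : ∀ e : Ext X' Y j, e = 0)
    (e : Ext X Y j) : e = 0 := by
  rw [← Ext.mk₀_id_comp e, ← i.hom_inv_id, ← Ext.mk₀_comp_mk₀,
    Ext.comp_assoc _ _ _ (zero_add 0) (zero_add j) (by simp),
    h (Ext.comp _ _ _), Ext.comp_zero]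

/-- Vanishing of `Ext` for the third object of a short exact sequence, in one degree. -/
lemma CategoryTheory.ShortComplex.ShortExact.ext_succ_eq_zero {S : ShortComplex C}
    (hS : S.ShortExact) {Y : C} {j : ℕ} (h₁ : ∀ e : Ext S.X₁ Y j, e = 0)
    (h₂ : ∀ e : Ext S.X₂ Y (j + 1), e = 0) (e : Ext S.X₃ Y (j + 1)) : e = 0 := by
  obtain ⟨x, rfl⟩ := Ext.contravariant_sequence_exact₃ hS Y e (h₂ _) (add_comm 1 j)
  rw [h₁ x, Ext.comp_zero]

/-- If the middle object of a short exact sequence is projective and maps out of the first object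
extend to it, then the first `Ext` group of the third object vanishes. -/
lemma CategoryTheory.ShortComplex.ShortExact.ext_one_eq_zero {S : ShortComplex C}
    (hS : S.ShortExact) (hP : Projective S.X₂) {Y : C}
    (h : ∀ f : S.X₁ ⟶ Y, ∃ g : S.X₂ ⟶ Y, S.f ≫ g = f) (e : Ext S.X₃ Y 1) : e = 0 := by
  obtain ⟨x, rfl⟩ :=
    Ext.contravariant_sequence_exact₃ hS Y e (Ext.eq_zero_of_projective _) (add_zero 1)
  obtain ⟨f, rfl⟩ := (Ext.mk₀_bijective _ _).2 x
  obtain ⟨g, rfl⟩ := h f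
  rw [← Ext.mk₀_comp_mk₀, ← Ext.comp_assoc _ _ _ (add_zero 1) _ (by simp), hS.extClass_comp,
    Ext.zero_comp]

/-- An object of finite projective dimension has projective dimension `< n` as soon as its `Ext`
groups with projective coefficients vanish in degrees `≥ n`. -/
lemma hasProjectiveDimensionLT_of_ext_projective [EnoughProjectives C] {X : C} {n : ℕ}
    (hX : ∀ (F : C) [Projective F] (j : ℕ) (_ : n ≤ j) (e : Ext X F j), e = 0) (d : ℕ)
    (hd : HasProjectiveDimensionLT X (n + d)) : HasProjectiveDimensionLT X n := by
  induction d with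
  | zero => exact hd
  | succ d ih =>
    refine ih ((hasProjectiveDimensionLT_iff _ _).2 fun i hi Y e ↦ ?_)
    have hS : (ShortComplex.mk (kernel.ι (Projective.π Y)) (Projective.π Y)
        (kernel.condition _)).ShortExact :=
      { exact := ShortComplex.exact_of_f_is_kernel _ (kernelIsKernel _) }
    -- With K the kernel of a projective cover map P → Y, the group Ext^i(X, Y) sits between
    -- Ext^i(X, P), zero by `hX`, and Ext^(i+1)(X, K), zero by the current dimension bound.
    obtain ⟨x, rfl⟩ := Ext.covariant_sequence_exact₃ X hS e rfl
      (Ext.eq_zero_of_hasProjectiveDimensionLT _ (n + (d + 1)) (by lia))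
    rw [hX _ i (by lia) x, Ext.zero_comp]

end Ext

/-! ### Complete resolutions and adjunctions -/

section Gorenstein

variable {A : Type u} [Ring A] {T : ChainComplex (ModuleCat.{u} A) ℤ}

/-- `Hom(T, V)` is exact. -/
def IsHomAcyclic (T : ChainComplex (ModuleCat.{u} A) ℤ) (V : ModuleCat.{u} A) : Prop :=
  ∀ (i : ℤ) (f : T.X i ⟶ V), T.d (i + 1) i ≫ f = 0 →
    ∃ g : T.X (i - 1) ⟶ V, T.d i (i - 1) ≫ g = f

lemma IsHomAcyclic.exists_comp_eq {V : ModuleCat.{u} A} (h : IsHomAcyclic T V) {j : ℤ}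
    (f : T.X (j + 1) ⟶ V) (hf : T.d (j + 1 + 1) (j + 1) ≫ f = 0) :
    ∃ g : T.X j ⟶ V, T.d (j + 1) j ≫ g = f := by
  have key (k : ℤ) (hk : k = j + 1 - 1) : ∃ g : T.X k ⟶ V, T.d (j + 1) k ≫ g = f := by
    subst hk
    exact h _ f hf
  exact key j (by simp)

lemma IsHomAcyclic.of_retract {V W : ModuleCat.{u} A} (h : IsHomAcyclic T W) (r : Retract V W) :
    IsHomAcyclic T V := fun i f hf ↦ by
  obtain ⟨g, hg⟩ := h i (f ≫ r.i) (by rw [reassoc_of% hf, zero_comp])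
  exact ⟨g ≫ r.r, by rw [reassoc_of% hg, r.retract, Category.comp_id]⟩

/-- `Hom(T, V)` is exact for a strong complete resolution `T` and a module `V` of projective
dimension at most one. -/
lemma IsStrongCompleteResolution.isHomAcyclic (hT : IsStrongCompleteResolution T)
    {S : ShortComplex (ModuleCat.{u} A)} (hS : S.ShortExact) (h₁ : Projective S.X₁)
    (h₂ : Projective S.X₂) : IsHomAcyclic T S.X₃ := fun i f hf ↦ by
  have := hT.projective
  have := hS.epi_g
  have := hS.mono_f
  -- The lift of `f` to `S.X₂` need not be a cocycle. Its coboundary lands in `S.X₁` and is itself a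
  -- cocycle, so it extends to some `k` on `T.X i`; subtracting `k ≫ S.f` corrects the lift without
  -- changing its image in `S.X₃`.
  have hf₀ : (T.d (i + 1) i ≫ Projective.factorThru f S.g) ≫ S.g = 0 := by simp [hf]
  have hl : T.d (i + 1 + 1) (i + 1) ≫ hS.exact.lift _ hf₀ = 0 := by
    rw [← cancel_mono S.f]; simp
  obtain ⟨k, hk⟩ := IsHomAcyclic.exists_comp_eq (hT.hom_acyclic S.X₁ h₁) _ hl
  obtain ⟨g, hg⟩ := hT.hom_acyclic S.X₂ h₂ i (Projective.factorThru f S.g - k ≫ S.f)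
    (by rw [Preadditive.comp_sub, reassoc_of% hk, hS.exact.lift_f, sub_self])
  exact ⟨g ≫ S.g, by rw [reassoc_of% hg]; simp⟩

variable {B : Type u} [Ring B] {L : ModuleCat.{u} A ⥤ ModuleCat.{u} B}
  {R : ModuleCat.{u} B ⥤ ModuleCat.{u} A}

open Abelian

/-- Let `L` be an exact left adjoint of `R` and `F` a module such that `Hom(T, R F)` is exact.
Then `Ext(L N, F)` vanishes in positive degrees for all cokernels `N` of `T`. -/
lemma IsStrongCompleteResolution.ext_map_cokernel_eq_zero (hT : IsStrongCompleteResolution T)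
    [PreservesFiniteLimits L] [PreservesFiniteColimits L] [L.Additive]
    [R.PreservesEpimorphisms] (adj : L ⊣ R) {F : ModuleCat.{u} B}
    (hF : IsHomAcyclic T (R.obj F))
    (j : ℕ) (i : ℤ) (e : Ext (L.obj (cokernel (T.d (i + 1) i))) F (j + 1)) : e = 0 := by
  have hS (i : ℤ) := (shortExact_cokernel_desc (T.d_comp_d (i + 1 + 1) (i + 1) i)
    ((T.exactAt_iff' (i + 1 + 1) (i + 1) i (by simp) (by simp)).1
      (hT.acyclic (i + 1)))).map_of_exact L
  have hP (i : ℤ) : Projective (L.obj (T.X i)) := adj.map_projective _ (hT.projective i)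
  induction j generalizing i with
  | zero =>
    refine (hS i).ext_one_eq_zero (hP i) (fun f ↦ ?_) e
    -- The adjoint of `f`, pulled back to `T.X (i + 1)`, is a cocycle with values in `R.obj F`.
    obtain ⟨g, hg⟩ := hF.exists_comp_eq (cokernel.π _ ≫ adj.homEquiv _ _ f) (by simp)
    refine ⟨(adj.homEquiv _ _).symm g, (adj.homEquiv _ _).injective ?_⟩
    rw [← cancel_epi (cokernel.π (T.d (i + 1 + 1) (i + 1))), ← hg]
    change _ ≫ adj.homEquiv _ _ (L.map (cokernel.desc _ _ _) ≫ (adj.homEquiv _ _).symm g) = _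
    rw [Adjunction.homEquiv_naturality_left]
    simp
  | succ j ih =>
    exact (hS i).ext_succ_eq_zero (ih (i + 1))
      (fun e ↦ Ext.eq_zero_of_projective (P := L.obj (T.X i)) e) e

/-- If `M` has a resolution of length `n` by Gorenstein projective modules, then
`Ext(L M, F)` vanishes in degrees `> n`. -/
lemma HasGorensteinProjectiveResolution.ext_map_eq_zero {M : ModuleCat.{u} A} {n : ℕ}
    (hM : HasGorensteinProjectiveResolution M n)
    [PreservesFiniteLimits L] [PreservesFiniteColimits L] [L.Additive] {F : ModuleCat.{u} B}
    (hF : ∀ N, IsGorensteinProjective N → ∀ (j : ℕ) (e : Ext (L.obj N) F (j + 1)), e = 0)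
    (j : ℕ) (hj : n + 1 ≤ j) (e : Ext (L.obj M) F j) : e = 0 := by
  obtain ⟨C, ε, w, hC, hzero, hex, hex₀, _⟩ := hM
  -- Induction runs down the syzygies: `m = n + 1 - k`, starting at `k = n + 1`, where the cokernel
  -- is a quotient of a zero module.
  have key (m k : ℕ) (hk : k + m = n + 1) (j : ℕ) (hj : m ≤ j)
      (e : Ext (L.obj (cokernel (C.d (k + 1) k))) F j) : e = 0 := by
    induction m generalizing k j with
    | zero =>
      have h₀ : IsZero (cokernel (C.d (k + 1) k)) :=
        (hzero k (by lia)).of_epi (cokernel.π _)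
      have := (L.map_isZero h₀).hasProjectiveDimensionLT_zero
      exact e.eq_zero_of_hasProjectiveDimensionLT 0 hj
    | succ m ih =>
      obtain ⟨j, rfl⟩ : ∃ i, j = i + 1 := ⟨j - 1, by lia⟩
      have hk' : (ShortComplex.mk (C.d (k + 1 + 1) (k + 1)) (C.d (k + 1) k) (by simp)).Exact :=
        (C.exactAt_iff' (k + 1 + 1) (k + 1) k (by simp) (by simp)).1 (hex k)
      exact ((shortExact_cokernel_desc _ hk').map_of_exact L).ext_succ_eq_zero
        (ih (k + 1) (by lia) j (by lia)) (hF _ (hC k) j) e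
  have i : cokernel (C.d 1 0) ≅ M :=
    (cokernelIsCokernel _).coconePointUniqueUpToIso hex₀.gIsCokernel
  exact ext_eq_zero_of_iso (L.mapIso i).symm (key (n + 1) 0 (by lia) j hj) e

end Gorenstein

open scoped TensorProduct
open MonoidAlgebra (single)

/-! ### Rationalization as an exact left adjoint -/

section Rationalization

variable (G : Type u) [Group G]

/-- The inclusion `ℤ[G] → ℚ[G]`. -/
noncomputable abbrev intToRat : MonoidAlgebra ℤ G →+* MonoidAlgebra ℚ G :=
  MonoidAlgebra.mapRingHom G (Int.castRingHom ℚ)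

variable (M : Type u) [AddCommGroup M] [Module (MonoidAlgebra ℤ G) M]

/-- The representation of `G` on `ℚ ⊗ M` for a `ℤ[G]`-module `M`. -/
noncomputable def rationalRepresentation : Representation ℚ G (ℚ ⊗[ℤ] M) :=
  (Module.End.baseChangeHom ℤ ℚ M).toMonoidHom.comp
    (Representation.ofModule' (k := ℤ) (G := G) M)

/-- The `ℚ[G]`-module `ℚ ⊗ M` of a `ℤ[G]`-module `M`. -/
abbrev Rationalization : Type u := (rationalRepresentation G M).asModule

variable {M}

/-- The element `q ⊗ m` of the rationalization of `M`. -/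
noncomputable def Rationalization.tmul (q : ℚ) (m : M) : Rationalization G M :=
  (rationalRepresentation G M).asModuleEquiv.symm (q ⊗ₜ m)

namespace Rationalization

lemma tmul_add (q : ℚ) (m m' : M) : tmul G q (m + m') = tmul G q m + tmul G q m' := by
  rw [tmul, TensorProduct.tmul_add, map_add]; rfl

lemma tmul_zero (q : ℚ) : tmul G q (0 : M) = 0 := by
  rw [tmul, TensorProduct.tmul_zero, map_zero]

lemma add_tmul (q q' : ℚ) (m : M) : tmul G (q + q') m = tmul G q m + tmul G q' m := by
  rw [tmul, TensorProduct.add_tmul, map_add]; rfl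

lemma zero_tmul (m : M) : tmul G 0 m = 0 := by
  rw [tmul, TensorProduct.zero_tmul, map_zero]

lemma tmul_zsmul (n : ℤ) (q : ℚ) (m : M) : tmul G q (n • m) = tmul G (n * q) m := by
  rw [tmul, ← TensorProduct.smul_tmul, tmul, zsmul_eq_mul]

lemma single_smul_tmul (g : G) (q q' : ℚ) (m : M) :
    single g q • tmul G q' m = tmul G (q * q') (single g (1 : ℤ) • m) := by
  rw [Representation.single_smul]
  rfl

variable {G} in
@[elab_as_elim]
lemma induction_on {p : Rationalization G M → Prop} (t : Rationalization G M) (zero : p 0)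
    (tmul : ∀ q m, p (tmul G q m)) (add : ∀ t t', p t → p t' → p (t + t')) : p t :=
  TensorProduct.induction_on (motive := p) t zero tmul add

/-- The canonical map `M → ℚ ⊗ M`. -/
noncomputable def mk : M →ₛₗ[intToRat G] Rationalization G M where
  toFun := tmul G 1
  map_add' := tmul_add G 1
  map_smul' x m := by
    induction x using MonoidAlgebra.induction_linear with
    | zero => rw [zero_smul, map_zero, zero_smul, tmul_zero]
    | add x y hx hy => rw [add_smul, tmul_add, hx, hy, map_add, add_smul]
    | single g n =>
      rw [MonoidAlgebra.mapRingHom_single, single_smul_tmul, eq_intCast, ← tmul_zsmul,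
        ← smul_assoc, MonoidAlgebra.smul_single, smul_eq_mul, mul_one]

variable {G} {N : Type u} [AddCommGroup N] [Module (MonoidAlgebra ℚ G) N]

/-- The additive map underlying `Rationalization.lift`. -/
noncomputable def liftAddHom (f : M →ₛₗ[intToRat G] N) : Rationalization G M →+ N :=
  (TensorProduct.liftAddHom (R := ℤ)
    (AddMonoidHom.mk' (fun q : ℚ ↦ (AddMonoidHom.mk' (fun m ↦ single (1 : G) q • f m)
      fun m m' ↦ by rw [map_add, smul_add])) fun q q' ↦ by
        ext m; simp [MonoidAlgebra.single_add, add_smul])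
    (fun n q m ↦ by
      simp only [AddMonoidHom.mk'_apply, map_zsmul f]
      rw [smul_comm (single (1 : G) q) n (f m), ← smul_assoc, MonoidAlgebra.smul_single])).comp
    (rationalRepresentation G M).asModuleEquiv.toAddMonoidHom

lemma liftAddHom_tmul (f : M →ₛₗ[intToRat G] N) (q : ℚ) (m : M) :
    liftAddHom f (tmul G q m) = single (1 : G) q • f m := rfl

/-- The `ℚ[G]`-linear extension of a semilinear map to `ℚ ⊗ M`. -/
noncomputable def lift (f : M →ₛₗ[intToRat G] N) :
    Rationalization G M →ₗ[MonoidAlgebra ℚ G] N where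
  __ := liftAddHom f
  map_smul' x t := by
    change liftAddHom f (x • t) = x • liftAddHom f t
    induction t using induction_on with
    | zero => simp
    | add t t' h h' => rw [smul_add, map_add, map_add, h, h', smul_add]
    | tmul q m =>
      induction x using MonoidAlgebra.induction_linear with
      | zero => simp
      | add x y hx hy => rw [add_smul, map_add, hx, hy, add_smul]
      | single g q' =>
        rw [single_smul_tmul, liftAddHom_tmul, liftAddHom_tmul, map_smulₛₗ,
          MonoidAlgebra.mapRingHom_single, ← mul_smul, ← mul_smul,
          MonoidAlgebra.single_mul_single, MonoidAlgebra.single_mul_single]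
        simp

lemma lift_tmul (f : M →ₛₗ[intToRat G] N) (q : ℚ) (m : M) :
    lift f (tmul G q m) = single (1 : G) q • f m := rfl

/-- Linear maps out of `ℚ ⊗ M` are semilinear maps out of `M`. -/
noncomputable def liftEquiv :
    (M →ₛₗ[intToRat G] N) ≃ (Rationalization G M →ₗ[MonoidAlgebra ℚ G] N) where
  toFun := lift
  invFun f := f.comp (mk G)
  left_inv f := by
    ext m
    refine (lift_tmul f 1 m).trans ?_
    rw [← MonoidAlgebra.one_def, one_smul]
  right_inv f := by
    ext t
    induction t using induction_on with
    | zero => rw [map_zero, map_zero]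
    | add t t' h h' => rw [map_add, map_add, h, h']
    | tmul q m =>
      rw [lift_tmul, LinearMap.comp_apply, ← map_smul]
      change f (_ • tmul G 1 m) = _
      rw [single_smul_tmul, ← MonoidAlgebra.one_def, one_smul, mul_one]

/-- Rationalization preserves injective maps, as `ℚ` is flat. -/
lemma lift_mk_comp_injective {M' : Type u} [AddCommGroup M'] [Module (MonoidAlgebra ℤ G) M']
    (f : M →ₗ[MonoidAlgebra ℤ G] M') (hf : Function.Injective f) :
    Function.Injective (lift ((mk G).comp f)) := by
  have h : Function.Injective (LinearMap.lTensor ℚ f.toAddMonoidHom.toIntLinearMap) :=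
    Module.Flat.lTensor_preserves_injective_linearMap _ hf
  have heq (t : Rationalization G M) :
      (rationalRepresentation G M').asModuleEquiv (lift ((mk G).comp f) t) =
        LinearMap.lTensor ℚ f.toAddMonoidHom.toIntLinearMap
          ((rationalRepresentation G M).asModuleEquiv t) := by
    induction t using induction_on with
    | zero => simp only [map_zero]
    | add t t' h h' => simp only [map_add, h, h']
    | tmul q m =>
      rw [lift_tmul]
      change (rationalRepresentation G M').asModuleEquiv (_ • tmul G 1 (f m)) = _
      rw [single_smul_tmul, ← MonoidAlgebra.one_def, one_smul, mul_one]
      rfl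
  intro t t' htt'
  apply (rationalRepresentation G M).asModuleEquiv.injective
  apply h
  rw [← heq, ← heq, htt']

end Rationalization

variable {G}

/-- Rationalization is left adjoint to restriction of scalars, on morphism sets. -/
noncomputable def rationalizationHomEquiv {G : Type u} [Group G]
    (M : ModuleCat.{u} (MonoidAlgebra ℤ G)) (N : ModuleCat.{u} (MonoidAlgebra ℚ G)) :
    (ModuleCat.of (MonoidAlgebra ℚ G) (Rationalization G M) ⟶ N) ≃
      (M ⟶ (ModuleCat.restrictScalars (intToRat G)).obj N) :=
  ModuleCat.homEquiv.trans (Rationalization.liftEquiv.symm.trans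
    (ModuleCat.semilinearMapAddEquiv (intToRat G) M N).toEquiv)

/-- The rationalization functor. -/
noncomputable def rationalizationFunctor (G : Type u) [Group G] :
    ModuleCat.{u} (MonoidAlgebra ℤ G) ⥤ ModuleCat.{u} (MonoidAlgebra ℚ G) :=
  Adjunction.leftAdjointOfEquiv (G := ModuleCat.restrictScalars (intToRat G))
    rationalizationHomEquiv fun _ _ _ _ _ ↦ rfl

/-- Rationalization is left adjoint to restriction of scalars. -/
noncomputable def rationalizationAdjunction (G : Type u) [Group G] :
    rationalizationFunctor G ⊣ ModuleCat.restrictScalars (intToRat G) :=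
  Adjunction.adjunctionOfEquivLeft rationalizationHomEquiv fun _ _ _ _ _ ↦ rfl

instance : (rationalizationFunctor G).Additive :=
  (rationalizationAdjunction G).left_adjoint_additive

instance : PreservesFiniteColimits (rationalizationFunctor G) :=
  have := (rationalizationAdjunction G).leftAdjoint_preservesColimits
  inferInstance

instance : (rationalizationFunctor G).PreservesMonomorphisms where
  preserves {M N} f hf := by
    rw [ModuleCat.mono_iff_injective] at hf ⊢
    exact Rationalization.lift_mk_comp_injective f.hom hf

instance : PreservesFiniteLimits (rationalizationFunctor G) := by
  -- A left adjoint is already right exact, so only preservation of monomorphisms, that is flatness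
  -- of ℚ, has to be added.
  refine ((Functor.preservesFiniteLimits_tfae _).out 0 3).1 fun S hS ↦ ?_
  have := hS.mono_f
  have hc : PreservesFiniteColimits (rationalizationFunctor G) := inferInstance
  have h := (Functor.preservesFiniteColimits_tfae (rationalizationFunctor G)).out 0 3
  exact ⟨(h.2 hc S hS).1, inferInstance⟩

end Rationalization

/-! ### Rationalization of the trivial module -/

section Trivial

variable (G : Type u) [Group G]

/-- The inclusion `ℤ → ℚ` of trivial modules. -/
noncomputable def trivialIntToRat :
    (Representation.trivial ℤ G (ULift.{u} ℤ)).asModule →ₛₗ[intToRat G]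
    (Representation.trivial ℚ G (ULift.{u} ℚ)).asModule where
  toFun n := (Representation.trivial ℚ G (ULift.{u} ℚ)).asModuleEquiv.symm
    ⟨((Representation.trivial ℤ G (ULift.{u} ℤ)).asModuleEquiv n).down⟩
  map_add' n n' := by
    rw [map_add, ULift.add_down, Int.cast_add]
    rfl
  map_smul' x n := by
    induction x using MonoidAlgebra.induction_linear with
    | zero =>
      rw [zero_smul, map_zero (intToRat G), zero_smul]
      exact congrArg ULift.up Int.cast_zero
    | add x y hx hy =>
      rw [map_add, add_smul, add_smul, ← hx, ← hy, map_add, ULift.add_down, Int.cast_add]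
      rfl
    | single g k =>
      rw [MonoidAlgebra.mapRingHom_single, Representation.single_smul, Representation.single_smul]
      exact congrArg ULift.up (Int.cast_mul _ _)

/-- Since q ⊗ m = mq ⊗ 1, every element has the form q ⊗ 1, and its image is q. -/
lemma lift_trivialIntToRat_bijective :
    Function.Bijective (Rationalization.lift (trivialIntToRat G)) := by
  set e := (Representation.trivial ℤ G (ULift.{u} ℤ)).asModuleEquiv.symm ⟨1⟩ with he
  have h (t : Rationalization G (Representation.trivial ℤ G (ULift.{u} ℤ)).asModule) :
      ∃ q : ℚ, t = Rationalization.tmul G q e := by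
    induction t using Rationalization.induction_on with
    | zero => exact ⟨0, (Rationalization.zero_tmul G e).symm⟩
    | add t t' h h' =>
      obtain ⟨q, rfl⟩ := h
      obtain ⟨q', rfl⟩ := h'
      exact ⟨q + q', (Rationalization.add_tmul G q q' e).symm⟩
    | tmul q m =>
      have hm : m = m.down • e := congrArg ULift.up (mul_one m.down).symm
      exact ⟨m.down * q, by rw [← Rationalization.tmul_zsmul, ← hm]⟩
  have h' (q : ℚ) : Rationalization.lift (trivialIntToRat G) (Rationalization.tmul G q e) =
      (Representation.trivial ℚ G (ULift.{u} ℚ)).asModuleEquiv.symm ⟨q⟩ := by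
    rw [Rationalization.lift_tmul, Representation.single_smul]
    refine congrArg ULift.up ?_
    change q * ((1 : ℤ) : ℚ) = q
    simp
  constructor
  · intro t t' htt'
    obtain ⟨q, rfl⟩ := h t
    obtain ⟨q', rfl⟩ := h t'
    rw [h', h'] at htt'
    rw [show q = q' from congrArg ULift.down htt']
  · exact fun x ↦ ⟨_, h' x.down⟩

/-- The rationalization of the trivial module `ℤ` is the trivial module `ℚ`. -/
noncomputable def rationalizationTrivialIso :
    (rationalizationFunctor G).obj (trivialModule ℤ G) ≅ trivialModule ℚ G :=
  LinearEquiv.toModuleIso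
    (X₁ := Rationalization G (Representation.trivial ℤ G (ULift.{u} ℤ)).asModule)
    (X₂ := (Representation.trivial ℚ G (ULift.{u} ℚ)).asModule)
    (LinearEquiv.ofBijective _ (lift_trivialIntToRat_bijective G))

end Trivial

/-! ### The telescope of multiplications by 1, 2, 3, … -/

section Telescope

variable {A : Type u} [Ring A] {W V : Type u} [AddCommGroup W] [Module A W] [AddCommGroup V]
  [Module A V] [Module ℚ V]

variable (A W) in
/-- The relations `eₙ w = (n + 1) eₙ₊₁ w` presenting the telescope of multiplications by
`1, 2, 3, …` on `W`. -/
noncomputable def telescopeRelations : (ℕ →₀ W) →ₗ[A] (ℕ →₀ W) :=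
  Finsupp.lsum ℕ fun n ↦ Finsupp.lsingle n - (n + 1) • Finsupp.lsingle (n + 1)

/-- The map from the telescope sending `eₙ w` to `w / n!`. -/
noncomputable def telescopeMap (j : W →ₗ[A] V) : (ℕ →₀ W) →ₗ[A] V :=
  Finsupp.lsum ℕ fun n ↦ ((n.factorial : ℚ)⁻¹ • j)

lemma telescopeRelations_single (n : ℕ) (w : W) : telescopeRelations A W (Finsupp.single n w) =
    Finsupp.single n w - Finsupp.single (n + 1) ((n + 1) • w) := by
  simp [telescopeRelations]

lemma telescopeMap_single (j : W →ₗ[A] V) (n : ℕ) (w : W) :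
    telescopeMap j (Finsupp.single n w) = (n.factorial : ℚ)⁻¹ • j w := by
  simp [telescopeMap]

/-- The image of x has coordinates x₀ and xₖ₊₁ - (k + 1) xₖ, so a kernel element vanishes coordinate
by coordinate; `W` may have torsion. -/
lemma telescopeRelations_injective : Function.Injective (telescopeRelations A W) := by
  rw [injective_iff_map_eq_zero]
  intro x hx
  have h0 (x : ℕ →₀ W) : telescopeRelations A W x 0 = x 0 := by
    induction x using Finsupp.induction_linear with
    | zero => simp
    | add x y hx hy => simp [hx, hy]
    | single n w => simp [telescopeRelations_single]
  have hs (x : ℕ →₀ W) (k : ℕ) :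
      telescopeRelations A W x (k + 1) = x (k + 1) - (k + 1) • x k := by
    induction x using Finsupp.induction_linear with
    | zero => simp
    | add x y hx hy => simp only [map_add, Finsupp.add_apply, hx, hy, smul_add]; abel
    | single n w =>
      rw [telescopeRelations_single, Finsupp.sub_apply]
      obtain rfl | h := eq_or_ne n k
      · simp
      · simp [Finsupp.single_apply, h]
  ext k
  induction k with
  | zero => rw [← h0, hx]
  | succ k ih =>
    have := hs x k
    rw [hx, ih] at this
    simpa using this.symm

lemma telescopeMap_telescopeRelations (j : W →ₗ[A] V) (x : ℕ →₀ W) :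
    telescopeMap j (telescopeRelations A W x) = 0 := by
  induction x using Finsupp.induction_linear with
  | zero => simp
  | add x y hx hy => simp [hx, hy]
  | single n w =>
    rw [telescopeRelations_single, map_sub, telescopeMap_single, telescopeMap_single, map_nsmul,
      ← Nat.cast_smul_eq_nsmul ℚ, smul_smul, Nat.factorial_succ, sub_eq_zero]
    congr 1
    have := n.factorial_ne_zero
    push_cast
    field_simp

/-- The relations push each term to any later index. Allowing all large `m` lets two elements be
moved to a common index and added. -/
lemma exists_sub_single_mem_range_telescopeRelations (x : ℕ →₀ W) :
    ∃ n, ∀ m, n ≤ m → ∃ w, x - Finsupp.single m w ∈ LinearMap.range (telescopeRelations A W) := by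
  induction x using Finsupp.induction_linear with
  | zero => exact ⟨0, fun m _ ↦ ⟨0, by simp⟩⟩
  | add x y hx hy =>
    obtain ⟨n, hn⟩ := hx
    obtain ⟨n', hn'⟩ := hy
    refine ⟨max n n', fun m hm ↦ ?_⟩
    obtain ⟨w, hw⟩ := hn m (by lia)
    obtain ⟨w', hw'⟩ := hn' m (by lia)
    refine ⟨w + w', ?_⟩
    rw [Finsupp.single_add, add_sub_add_comm]
    exact add_mem hw hw'
  | single n w =>
    refine ⟨n, fun m hm ↦ ?_⟩
    induction m, hm using Nat.le_induction with
    | base => exact ⟨w, by simp⟩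
    | succ m _ ih =>
      obtain ⟨w', hw'⟩ := ih
      refine ⟨(m + 1) • w', ?_⟩
      convert! add_mem hw' (LinearMap.mem_range_self _ (Finsupp.single m w')) using 1
      rw [telescopeRelations_single]
      abel

/-- Modulo relations a kernel element is a single term eₙ w with j(w) / n! = 0, hence w = 0. -/
lemma telescope_exact (j : W →ₗ[A] V) (hj : Function.Injective j) :
    Function.Exact (telescopeRelations A W) (telescopeMap j) := by
  refine fun x ↦ ⟨fun hx ↦ ?_, ?_⟩
  · obtain ⟨n, hn⟩ := exists_sub_single_mem_range_telescopeRelations (A := A) x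
    obtain ⟨w, y, hy⟩ := hn n le_rfl
    have h := telescopeMap_telescopeRelations j y
    rw [hy, map_sub, hx, zero_sub, neg_eq_zero, telescopeMap_single, smul_eq_zero_iff_right
      (by simp [Nat.factorial_ne_zero]), map_eq_zero_iff j hj] at h
    exact ⟨y, by simpa [h] using hy⟩
  · rintro ⟨y, rfl⟩
    exact telescopeMap_telescopeRelations j y

lemma telescopeMap_surjective (j : W →ₗ[A] V)
    (hj : ∀ v, ∃ n : ℕ, n ≠ 0 ∧ n • v ∈ LinearMap.range j) :
    Function.Surjective (telescopeMap j) := by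
  intro v
  obtain ⟨n, hn, w, hw⟩ := hj v
  obtain ⟨m, rfl⟩ := Nat.exists_eq_succ_of_ne_zero hn
  -- The value is m! j(w) / (m + 1)! = j(w) / (m + 1) = v.
  refine ⟨Finsupp.single (m + 1) (m.factorial • w), ?_⟩
  rw [telescopeMap_single, map_nsmul, hw, ← Nat.cast_smul_eq_nsmul ℚ, ← Nat.cast_smul_eq_nsmul ℚ,
    smul_smul, smul_smul, Nat.factorial_succ]
  have := m.factorial_ne_zero
  convert! one_smul ℚ v
  push_cast
  field_simp

end Telescope

/-! ### Projective ℚG-modules restricted to ℤG -/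

section FreeRational

variable (G : Type u) [Group G] (ι : Type u)

/-- The inclusion of the free `ℤ[G]`-module into the free `ℚ[G]`-module on `ι`. -/
noncomputable def freeIntToRat : (ι →₀ MonoidAlgebra ℤ G) →ₗ[MonoidAlgebra ℤ G]
    (ModuleCat.restrictScalars (intToRat G)).obj
      (ModuleCat.of (MonoidAlgebra ℚ G) (ι →₀ MonoidAlgebra ℚ G)) where
  toFun x := (x.mapRange (intToRat G) (map_zero _) : ι →₀ MonoidAlgebra ℚ G)
  map_add' x y := Finsupp.mapRange_add (map_add _) x y
  map_smul' a x := by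
    refine Finsupp.ext fun i ↦ ?_
    exact map_mul (intToRat G) a (x i)

lemma freeIntToRat_injective : Function.Injective (freeIntToRat G ι) := by
  refine Finsupp.mapRange_injective _ (map_zero _) fun x y h ↦ ?_
  ext g
  have := congrArg (fun z ↦ z.coeff g) h
  simpa using this

/-- Finitely many coefficients have a common denominator. -/
lemma exists_nsmul_mem_range_freeIntToRat (v : ι →₀ MonoidAlgebra ℚ G) :
    ∃ n : ℕ, n ≠ 0 ∧ ∃ w, freeIntToRat G ι w = n • v := by
  have hadd {v v' : ι →₀ MonoidAlgebra ℚ G}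
      (h : ∃ n : ℕ, n ≠ 0 ∧ ∃ w, freeIntToRat G ι w = n • v)
      (h' : ∃ n : ℕ, n ≠ 0 ∧ ∃ w, freeIntToRat G ι w = n • v') :
      ∃ n : ℕ, n ≠ 0 ∧ ∃ w, freeIntToRat G ι w = n • (v + v') := by
    obtain ⟨n, hn, w, hw⟩ := h
    obtain ⟨n', hn', w', hw'⟩ := h'
    refine ⟨n * n', mul_ne_zero hn hn', n' • w + n • w', ?_⟩
    rw [map_add, map_nsmul, map_nsmul, hw, hw', smul_add, mul_comm, mul_smul, mul_comm, mul_smul]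
    rfl
  induction v using Finsupp.induction_linear with
  | zero => exact ⟨1, one_ne_zero, 0, by rw [map_zero, smul_zero]; rfl⟩
  | add v v' h h' => exact hadd h h'
  | single i x =>
    induction x using MonoidAlgebra.induction_linear with
    | zero => exact ⟨1, one_ne_zero, 0, by rw [map_zero, Finsupp.single_zero, smul_zero]; rfl⟩
    | add x y hx hy => rw [Finsupp.single_add]; exact hadd hx hy
    | single g q =>
      refine ⟨q.den, q.den_ne_zero, Finsupp.single i (single g q.num), ?_⟩
      refine (Finsupp.mapRange_single (hf := map_zero _)).trans ?_
      rw [MonoidAlgebra.mapRingHom_single, Finsupp.smul_single, MonoidAlgebra.smul_single]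
      congr 2
      rw [nsmul_eq_mul, mul_comm, Rat.mul_den_eq_num, eq_intCast]

variable {G}

/-- `Hom(T, F)` is exact for a strong complete resolution `T` over `ℤ[G]` and a projective
`ℚ[G]`-module `F`. -/
lemma IsStrongCompleteResolution.isHomAcyclic_restrictScalars
    {T : ChainComplex (ModuleCat.{u} (MonoidAlgebra ℤ G)) ℤ} (hT : IsStrongCompleteResolution T)
    (F : ModuleCat.{u} (MonoidAlgebra ℚ G)) [Projective F] :
    IsHomAcyclic T ((ModuleCat.restrictScalars (intToRat G)).obj F) := by
  have hF : Module.Projective (MonoidAlgebra ℚ G) F :=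
    (IsProjective.iff_projective F).2 ‹_›
  obtain ⟨s, hs⟩ := hF.out
  let r : Retract F (ModuleCat.of (MonoidAlgebra ℚ G) (F →₀ MonoidAlgebra ℚ G)) :=
    { i := ModuleCat.ofHom s
      r := ModuleCat.ofHom (Finsupp.linearCombination _ id)
      retract := by ext x; exact hs x }
  -- Passing to the free module on the elements of `F` makes available a ℤG-lattice whose telescope
  -- is a two-term free resolution.
  refine IsHomAcyclic.of_retract ?_ (r.map (ModuleCat.restrictScalars (intToRat G)))
  let V := (ModuleCat.restrictScalars (intToRat G)).obj
    (ModuleCat.of (MonoidAlgebra ℚ G) (F →₀ MonoidAlgebra ℚ G))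
  let _ : Module ℚ V := (inferInstance : Module ℚ (F →₀ MonoidAlgebra ℚ G))
  let j : (F →₀ MonoidAlgebra ℤ G) →ₗ[MonoidAlgebra ℤ G] V := freeIntToRat G F
  have hP : Projective (ModuleCat.of (MonoidAlgebra ℤ G) (ℕ →₀ F →₀ MonoidAlgebra ℤ G)) :=
    (IsProjective.iff_projective _).1 inferInstance
  refine hT.isHomAcyclic (S := ShortComplex.mk
    (ModuleCat.ofHom (telescopeRelations (MonoidAlgebra ℤ G) (F →₀ MonoidAlgebra ℤ G)))
    (ModuleCat.ofHom (telescopeMap j))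
    (ModuleCat.hom_ext (LinearMap.ext (telescopeMap_telescopeRelations j)))) ?_ hP hP
  exact ModuleCat.shortComplex_shortExact _ (telescope_exact j (freeIntToRat_injective G F))
    telescopeRelations_injective
    (telescopeMap_surjective j (exists_nsmul_mem_range_freeIntToRat G F))

end FreeRational

open Abelian in
/-- Let `F` be a projective `ℚ[G]`-module. Then `Ext(ℚ ⊗ N, F)` vanishes in positive degrees
for every Gorenstein projective `ℤ[G]`-module `N`. -/
lemma IsGorensteinProjective.ext_rationalization_eq_zero {G : Type u} [Group G]
    {N : ModuleCat.{u} (MonoidAlgebra ℤ G)} (hN : IsGorensteinProjective N)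
    (F : ModuleCat.{u} (MonoidAlgebra ℚ G)) [Projective F] (j : ℕ)
    (e : Ext ((rationalizationFunctor G).obj N) F (j + 1)) : e = 0 := by
  obtain ⟨T, hT, k, ⟨i⟩⟩ := hN
  exact ext_eq_zero_of_iso ((rationalizationFunctor G).mapIso i)
    (hT.ext_map_cokernel_eq_zero (rationalizationAdjunction G)
      (hT.isHomAcyclic_restrictScalars F) j k) e

theorem mainTheorem6 (G : Type u) [Group G] (h : cohomologicalDimension ℚ G < ⊤) :
    cohomologicalDimension ℚ G ≤ (gorensteinCohomologicalDimension ℤ G : WithBot ℕ∞) := by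
  obtain hs | hs := Set.eq_empty_or_nonempty
    {d : ℕ∞ | ∃ n : ℕ, d = n ∧ HasGorensteinProjectiveResolution (trivialModule ℤ G) n}
  · rw [gorensteinCohomologicalDimension, gorensteinProjectiveDimension, hs, sInf_empty]
    exact le_top
  -- A nonempty set in ℕ∞ attains its infimum, so a resolution of minimal length exists.
  obtain ⟨n, hn, hres⟩ := csInf_mem hs
  rw [gorensteinCohomologicalDimension, gorensteinProjectiveDimension, hn]
  refine (projectiveDimension_le_iff _ n).2 ?_
  obtain ⟨d, hd⟩ := (projectiveDimension_ne_top_iff _).1 h.ne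
  have : HasProjectiveDimensionLT (trivialModule ℚ G) (d + 1) := hd
  refine hasProjectiveDimensionLT_of_ext_projective (fun F _ j hj e ↦ ?_) d
    (hasProjectiveDimensionLT_of_ge _ (d + 1) _ (by lia))
  exact ext_eq_zero_of_iso (rationalizationTrivialIso G).symm
    (hres.ext_map_eq_zero (fun N hN ↦ hN.ext_rationalization_eq_zero F) j hj) e
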